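/- For a topological space $X$ let $\mathscr E(X)$ be the group of (free) homotopy classes of homotopy self-equivalences of $X$, i.e. the group of units of the monoid $[X,X]$ under composition. For a continuous map $f:X\to Y$ let $$\mathscr E(f)=\{([h_X],[h_Y])\in\mathscr E(X)\times\mathscr E(Y)\mid f\circ h_X\simeq h_Y\circ f\},$$ a subgroup of $\mathscr E(X)\times\mathscr E(Y)$. For continuous maps $f:X\to Y$ and $g:Y\to Z$ put $$\mathscr E(g)\,\copyright\,\mathscr E(f)=\{([h_X],[h_Z])\mid \exists\,[h_Y]\in\mathscr E(Y):\ ([h_X],[h_Y])\in\mathscr E(f),\ ([h_Y],[h_Z])\in\mathscr E(g)\},$$ and call $(f,g)$ an $\mathscr E$-strict-functor pair if $\mathscr E(g)\,\copyright\,\mathscr E(f)=\mathscr E(g\circ f)$. 1. Let $X$ be a path-connected space and $x_0\in X$. Let $PX$ be the space of continuous paths $\gamma:[0,1]\to X$ with $\gamma(0)=x_0$ and $\Omega X$ the space of loops at $x_0$, both with the compact-open topology. Let $f:\Omega X\hookrightarrow PX$ be the inclusion and $g:PX\to X$, $g(\gamma)=\gamma(1)$. Then $PX$ is contractible and $(f,g)$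 is an $\mathscr E$-strict-functor pair. 2. Let $G$ be a topological group. Let $EG$ be Milnor's infinite join $G*G*G*\cdots$: its points are the formal sums $t_0x_0\oplus t_1x_1\oplus\cdots$ with $x_i\in G$, $t_i\ge 0$, almost all $t_i=0$ and $\sum_i t_i=1$, where $x_i$ is disregarded if $t_i=0$; its topology is the coarsest one for which all $t_i:EG\to[0,1]$ and all $x_i:t_i^{-1}(0,1]\to G$ are continuous. The group $G$ acts on $EG$ from the right by $(\bigoplus_i t_ix_i)\cdot g=\bigoplus_i t_i(x_ig)$. Let $BG=EG/G$ with the quotient topology, let $g:EG\to BG$ be the projection, and for $e\in EG$ let $f_e:G\to EG$, $f_e(a)=e\cdot a$, be the fibre through $e$. Then $EG$ is contractible and, for every $e\in EG$, $(f_e,g)$ is an $\mathscr E$-strict-functor pair. -/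

import Mathlib

open scoped unitInterval Topology

noncomputable section

/-! ### Homotopy classes of maps and the group of homotopy self-equivalences -/

/-- Free (unpointed) homotopy as an equivalence relation on continuous maps. -/
def homotopicSetoid (X Y : Type*) [TopologicalSpace X] [TopologicalSpace Y] : Setoid C(X, Y) :=
  ⟨ContinuousMap.Homotopic, ContinuousMap.Homotopic.equivalence⟩

/-- The set `[X, Y]` of free homotopy classes of continuous maps. -/
def HomotopyClass (X Y : Type*) [TopologicalSpace X] [TopologicalSpace Y] : Type _ :=
  Quotient (homotopicSetoid X Y)

namespace HomotopyClass

variable {X Y Z W : Type*} [TopologicalSpace X] [TopologicalSpace Y] [TopologicalSpace Z]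
  [TopologicalSpace W]

/-- The homotopy class `[f]` of a continuous map `f`. -/
def mk (f : C(X, Y)) : HomotopyClass X Y := Quotient.mk (homotopicSetoid X Y) f

theorem mk_eq_mk_iff (f g : C(X, Y)) : mk f = mk g ↔ f.Homotopic g :=
  Quotient.eq (r := homotopicSetoid X Y)

/-- Composition of homotopy classes, `[g][f] = [g ∘ f]`. -/
def comp (b : HomotopyClass Y Z) (a : HomotopyClass X Y) : HomotopyClass X Z :=
  Quotient.map₂ (sa := homotopicSetoid Y Z) (sb := homotopicSetoid X Y)
    (sc := homotopicSetoid X Z) (fun g f => g.comp f)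
    (fun _ _ hg _ _ hf => ContinuousMap.Homotopic.comp hg hf) b a

@[simp] theorem comp_mk (g : C(Y, Z)) (f : C(X, Y)) : comp (mk g) (mk f) = mk (g.comp f) := rfl

theorem comp_assoc (c : HomotopyClass Z W) (b : HomotopyClass Y Z) (a : HomotopyClass X Y) :
    comp (comp c b) a = comp c (comp b a) := by
  induction c using Quotient.ind
  induction b using Quotient.ind
  induction a using Quotient.ind
  rfl

@[simp] theorem id_comp (a : HomotopyClass X Y) : comp (mk (ContinuousMap.id Y)) a = a := by
  induction a using Quotient.ind
  rfl

@[simp] theorem comp_id (a : HomotopyClass X Y) : comp a (mk (ContinuousMap.id X)) = a := by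
  induction a using Quotient.ind
  rfl

/-- The monoid `[X, X]` under composition. -/
instance : Monoid (HomotopyClass X X) where
  mul := comp
  one := mk (ContinuousMap.id X)
  mul_assoc := comp_assoc
  one_mul := id_comp
  mul_one := comp_id

theorem mul_def (b a : HomotopyClass X X) : b * a = comp b a := rfl

theorem one_def : (1 : HomotopyClass X X) = mk (ContinuousMap.id X) := rfl

end HomotopyClass

/-- The group `𝓔(X)` of homotopy classes of homotopy self-equivalences of `X`: the group of
units of the monoid `[X, X]`. -/
abbrev SelfEquivGroup (X : Type*) [TopologicalSpace X] : Type _ := (HomotopyClass X X)ˣ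

/-- The group `𝓔(f)` of a continuous map `f : X → Y`: the pairs `([h_X], [h_Y])` in
`𝓔(X) × 𝓔(Y)` with `f ∘ h_X ≃ h_Y ∘ f`. -/
def mapSelfEquivGroup {X Y : Type*} [TopologicalSpace X] [TopologicalSpace Y] (f : C(X, Y)) :
    Subgroup (SelfEquivGroup X × SelfEquivGroup Y) where
  carrier := {p | (HomotopyClass.mk f).comp (p.1 : HomotopyClass X X) =
    (p.2 : HomotopyClass Y Y).comp (HomotopyClass.mk f)}
  mul_mem' := by
    rintro ⟨a, b⟩ ⟨a', b'⟩ h h'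
    simp only [Set.mem_ofPred_eq, Prod.mk_mul_mk, Units.val_mul, HomotopyClass.mul_def] at h h' ⊢
    rw [← HomotopyClass.comp_assoc, h, HomotopyClass.comp_assoc, h', HomotopyClass.comp_assoc]
  one_mem' := by
    simp [HomotopyClass.one_def]
  inv_mem' := by
    rintro ⟨a, b⟩ h
    simp only [Set.mem_ofPred_eq, Prod.inv_mk] at h ⊢
    have ha : (a : HomotopyClass X X).comp ((a⁻¹ : SelfEquivGroup X) : HomotopyClass X X) =
        HomotopyClass.mk (ContinuousMap.id X) := a.mul_inv
    have hb : ((b⁻¹ : SelfEquivGroup Y) : HomotopyClass Y Y).comp (b : HomotopyClass Y Y) =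
        HomotopyClass.mk (ContinuousMap.id Y) := b.inv_mul
    calc (HomotopyClass.mk f).comp ((a⁻¹ : SelfEquivGroup X) : HomotopyClass X X)
        = (((b⁻¹ : SelfEquivGroup Y) : HomotopyClass Y Y).comp
            ((b : HomotopyClass Y Y).comp (HomotopyClass.mk f))).comp
              ((a⁻¹ : SelfEquivGroup X) : HomotopyClass X X) := by
          rw [← HomotopyClass.comp_assoc _ (b : HomotopyClass Y Y), hb, HomotopyClass.id_comp]
      _ = ((b⁻¹ : SelfEquivGroup Y) : HomotopyClass Y Y).comp (HomotopyClass.mk f) := by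
          rw [← h, HomotopyClass.comp_assoc, HomotopyClass.comp_assoc, ha, HomotopyClass.comp_id]

/-- The fiber-duct composition `S' © S` of correspondences of groups `S ≤ G × F`, `S' ≤ F × K`:
all `(g, k)` such that `(g, f) ∈ S` and `(f, k) ∈ S'` for some `f ∈ F`. -/
def fiberDuct {G F K : Type*} [Group G] [Group F] [Group K]
    (S' : Subgroup (F × K)) (S : Subgroup (G × F)) : Subgroup (G × K) where
  carrier := {p | ∃ f : F, (p.1, f) ∈ S ∧ (f, p.2) ∈ S'}
  mul_mem' := by
    rintro ⟨_, _⟩ ⟨_, _⟩ ⟨f, h1, h2⟩ ⟨f', h1', h2'⟩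
    exact ⟨f * f', S.mul_mem h1 h1', S'.mul_mem h2 h2'⟩
  one_mem' := ⟨1, S.one_mem, S'.one_mem⟩
  inv_mem' := by
    rintro ⟨_, _⟩ ⟨f, h1, h2⟩
    exact ⟨f⁻¹, S.inv_mem h1, S'.inv_mem h2⟩

/-- `(f, g)` is an `𝓔`-strict-functor pair if `𝓔(g) © 𝓔(f) = 𝓔(g ∘ f)`. -/
def IsStrictFunctorPair {X Y Z : Type*} [TopologicalSpace X] [TopologicalSpace Y]
    [TopologicalSpace Z] (f : C(X, Y)) (g : C(Y, Z)) : Prop :=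
  fiberDuct (mapSelfEquivGroup g) (mapSelfEquivGroup f) = mapSelfEquivGroup (g.comp f)

/-! ### The loop-path fibration -/

/-- The based path space `PX`: continuous maps `γ : [0, 1] → X` with `γ 0 = x₀`, with the
compact-open topology. -/
abbrev BasedPathSpace (X : Type*) [TopologicalSpace X] (x₀ : X) : Type _ :=
  {γ : C(I, X) // γ 0 = x₀}

/-- The inclusion `ΩX → PX` of the loop space `ΩX = Path x₀ x₀` (compact-open topology). -/
def loopInclusion {X : Type*} [TopologicalSpace X] (x₀ : X) :
    C(Path x₀ x₀, BasedPathSpace X x₀) where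
  toFun γ := ⟨γ.toContinuousMap, γ.source⟩
  continuous_toFun := Continuous.subtype_mk continuous_induced_dom _

/-- The end point map `PX → X`, `γ ↦ γ 1`. -/
def pathEndpoint {X : Type*} [TopologicalSpace X] (x₀ : X) : C(BasedPathSpace X x₀, X) where
  toFun γ := γ.1 1
  continuous_toFun := (continuous_eval_const (F := C(I, X)) (1 : I)).comp continuous_subtype_val

/-! ### Milnor's universal bundle -/

/-- Formal sums `t₀ x₀ ⊕ t₁ x₁ ⊕ ⋯` with `tᵢ ≥ 0` almost all zero, `∑ tᵢ = 1` and `xᵢ ∈ G`, are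
identified when they have the same weights `tᵢ`, and the same labels `xᵢ` wherever `tᵢ > 0`. -/
def milnorSetoid (G : Type*) : Setoid (Convexity.StdSimplex ℝ ℕ × (ℕ → G)) where
  r p q := p.1 = q.1 ∧ ∀ i, 0 < p.1.weights i → p.2 i = q.2 i
  iseqv :=
    { refl := fun _ => ⟨rfl, fun _ _ => rfl⟩
      symm := fun h => ⟨h.1.symm, fun i hi => (h.2 i (by rw [h.1]; exact hi)).symm⟩
      trans := fun h h' => ⟨h.1.trans h'.1, fun i hi =>
        (h.2 i hi).trans (h'.2 i (by rw [← h.1]; exact hi))⟩ }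

/-- The total space `EG = G * G * G * ⋯`, the infinite join. -/
def MilnorE (G : Type*) : Type _ := Quotient (milnorSetoid G)

namespace MilnorE

variable {G : Type*}

/-- The point `t₀ x₀ ⊕ t₁ x₁ ⊕ ⋯` of `EG`. -/
def mk (t : Convexity.StdSimplex ℝ ℕ) (x : ℕ → G) : MilnorE G := Quotient.mk (milnorSetoid G) (t, x)

theorem mk_eq_mk_iff (t t' : Convexity.StdSimplex ℝ ℕ) (x x' : ℕ → G) :
    mk t x = mk t' x' ↔ t = t' ∧ ∀ i, 0 < t.weights i → x i = x' i :=
  Quotient.eq (r := milnorSetoid G)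

theorem ind {P : MilnorE G → Prop} (h : ∀ t x, P (mk t x)) (e : MilnorE G) : P e :=
  Quotient.ind (fun p => h p.1 p.2) e

/-- The coordinate `tᵢ : EG → [0, 1]`. -/
def weight (i : ℕ) (e : MilnorE G) : ℝ :=
  Quotient.lift (s := milnorSetoid G) (fun p => p.1.weights i)
    (fun _ _ h => congrArg (fun t : Convexity.StdSimplex ℝ ℕ => t.weights i) h.1) e

@[simp] theorem weight_mk (i : ℕ) (t : Convexity.StdSimplex ℝ ℕ) (x : ℕ → G) :
    weight i (mk t x) = t.weights i := rfl

/-- The coordinate `xᵢ : tᵢ⁻¹(0, 1] → G`. -/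
def label (i : ℕ) (e : {e : MilnorE G // 0 < weight i e}) : G :=
  (Quotient.out (s := milnorSetoid G) e.1).2 i

@[simp] theorem label_mk (i : ℕ) (t : Convexity.StdSimplex ℝ ℕ) (x : ℕ → G)
    (h : 0 < weight i (mk t x)) : label i ⟨mk t x, h⟩ = x i := by
  have h1 := Quotient.mk_out (s := milnorSetoid G) (t, x)
  exact h1.2 i (by rw [h1.1]; exact h)

theorem mk_mem_image_label (i : ℕ) (V : Set G) (t : Convexity.StdSimplex ℝ ℕ) (x : ℕ → G) :
    mk t x ∈ Subtype.val '' (label i ⁻¹' V) ↔ 0 < t.weights i ∧ x i ∈ V := by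
  constructor
  · rintro ⟨⟨e, he⟩, hV, rfl⟩
    rw [Set.mem_preimage, label_mk] at hV
    exact ⟨he, hV⟩
  · rintro ⟨h, hV⟩
    have h' : 0 < weight i (mk t x) := h
    refine ⟨⟨mk t x, h'⟩, ?_, rfl⟩
    rw [Set.mem_preimage, label_mk]
    exact hV

/-- Milnor's strong topology: the coarsest topology making all the functions `tᵢ : EG → [0, 1]`
and `xᵢ : tᵢ⁻¹(0, 1] → G` continuous. -/
instance [TopologicalSpace G] : TopologicalSpace (MilnorE G) :=
  TopologicalSpace.generateFrom
    ({S | ∃ (i : ℕ) (U : Set ℝ), IsOpen U ∧ S = weight i ⁻¹' U} ∪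
      {S | ∃ (i : ℕ) (V : Set G), IsOpen V ∧ S = Subtype.val '' (label i ⁻¹' V)})

/-- The right action of `G` on `EG`, `(⨁ tᵢ xᵢ) g = ⨁ tᵢ (xᵢ g)`, as an action of the opposite
group. -/
instance [Group G] : MulAction Gᵐᵒᵖ (MilnorE G) where
  smul g := Quotient.map' (s₁ := milnorSetoid G) (s₂ := milnorSetoid G)
    (fun p => (p.1, fun i => p.2 i * g.unop))
    (fun _ _ h => ⟨h.1, fun i hi => congrArg (· * g.unop) (h.2 i hi)⟩)
  one_smul := ind fun _ _ => (mk_eq_mk_iff _ _ _ _).2 ⟨rfl, fun _ _ => mul_one _⟩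
  mul_smul _ _ := ind fun _ _ =>
    (mk_eq_mk_iff _ _ _ _).2 ⟨rfl, fun _ _ => (mul_assoc _ _ _).symm⟩

@[simp] theorem op_smul_mk [Group G] (g : G) (t : Convexity.StdSimplex ℝ ℕ) (x : ℕ → G) :
    MulOpposite.op g • mk t x = mk t (fun i => x i * g) := rfl

end MilnorE

/-- The classifying space `BG = EG / G`, with the quotient topology. -/
abbrev MilnorB (G : Type*) [TopologicalSpace G] [Group G] : Type _ :=
  MulAction.orbitRel.Quotient Gᵐᵒᵖ (MilnorE G)

/-- The projection `EG → BG`. -/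
def milnorProjection (G : Type*) [TopologicalSpace G] [Group G] : C(MilnorE G, MilnorB G) where
  toFun := Quotient.mk _
  continuous_toFun := continuous_quotient_mk'

/-- The fibre `G → EG` through the point `e`, `g ↦ e g`. -/
def milnorFiber {G : Type*} [TopologicalSpace G] [Group G] [IsTopologicalGroup G]
    (e : MilnorE G) : C(G, MilnorE G) where
  toFun g := MulOpposite.op g • e
  continuous_toFun := by
    induction e using MilnorE.ind with
    | h t x =>
      refine continuous_generateFrom_iff.2 ?_
      rintro S (⟨i, U, -, rfl⟩ | ⟨i, V, hV, rfl⟩)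
      · exact isOpen_const (p := t.weights i ∈ U)
      · by_cases hi : 0 < t.weights i
        · convert hV.preimage (continuous_const_mul (x i)) using 1
          ext g
          exact (MilnorE.mk_mem_image_label i V t (fun i => x i * g)).trans (and_iff_right hi)
        · convert isOpen_empty using 1
          ext g
          exact (MilnorE.mk_mem_image_label i V t (fun i => x i * g)).trans
            (iff_false_intro fun h => hi h.1)

end

noncomputable section

/-! Both pairs have a contractible middle space `Y` and a path-connected target `Z`. Every map `X →
Y`, `Y → Z`, or `X → Z` through `Y` is then nullhomotopic, and nullhomotopic maps into the same
path-connected space are homotopic. Hence the defining relation of each of the three groups always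
holds: all are full products, and any middle class, such as `1`, witnesses the composition.

What remains is contractibility. Paths are shortened to their starting point. In Milnor's join,
labels in `G` cannot be interpolated, so two summands must never meet at one position. The summands
first slide apart, the `i`-th from position `i` to `2i`, those of higher index leaving earlier;
between integers a summand shares its weight between the two neighbouring positions and carries its
label to both. Position `1` is then empty, and a linear homotopy moves all the weight there. -/

open ContinuousMap in
theorem ContinuousMap.Nullhomotopic.homotopic {W V : Type*} [TopologicalSpace W]
    [TopologicalSpace V] [PathConnectedSpace V] {u v : C(W, V)} (hu : u.Nullhomotopic)
    (hv : v.Nullhomotopic) : u.Homotopic v := by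
  obtain ⟨y, hy⟩ := hu
  obtain ⟨z, hz⟩ := hv
  refine hy.trans (Homotopic.trans ?_ hz.symm)
  rcases isEmpty_or_nonempty W with h | h
  · have : const W y = const W z := by
      ext w
      exact isEmptyElim w
    rw [this]
  · exact homotopic_const_iff.2 (PathConnectedSpace.joined y z)

/-- A contractible space in the middle forces the strict functor property, as all maps into a
contractible space, and all maps from it to a path-connected space, are homotopic. -/
theorem isStrictFunctorPair_of_contractibleSpace {X Y Z : Type*} [TopologicalSpace X]
    [TopologicalSpace Y] [TopologicalSpace Z] [ContractibleSpace Y] [PathConnectedSpace Z]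
    (f : C(X, Y)) (g : C(Y, Z)) : IsStrictFunctorPair f g := by
  have hX (u : C(X, Y)) : u.Nullhomotopic := (id_nullhomotopic Y).comp_left u
  have hZ (u : C(Y, Z)) : u.Nullhomotopic := (id_nullhomotopic Y).comp_right u
  have h1 (p : SelfEquivGroup X × SelfEquivGroup Y) : p ∈ mapSelfEquivGroup f := by
    obtain ⟨a, ha⟩ := Quotient.exists_rep (p.1 : HomotopyClass X X)
    obtain ⟨b, hb⟩ := Quotient.exists_rep (p.2 : HomotopyClass Y Y)
    change (HomotopyClass.mk f).comp (p.1 : HomotopyClass X X) =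
      (p.2 : HomotopyClass Y Y).comp (HomotopyClass.mk f)
    rw [← ha, ← hb]
    exact (HomotopyClass.mk_eq_mk_iff _ _).2 ((hX _).homotopic (hX _))
  have h2 (p : SelfEquivGroup Y × SelfEquivGroup Z) : p ∈ mapSelfEquivGroup g := by
    obtain ⟨a, ha⟩ := Quotient.exists_rep (p.1 : HomotopyClass Y Y)
    obtain ⟨b, hb⟩ := Quotient.exists_rep (p.2 : HomotopyClass Z Z)
    change (HomotopyClass.mk g).comp (p.1 : HomotopyClass Y Y) =
      (p.2 : HomotopyClass Z Z).comp (HomotopyClass.mk g)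
    rw [← ha, ← hb]
    exact (HomotopyClass.mk_eq_mk_iff _ _).2 ((hZ _).homotopic (hZ _))
  have h3 (p : SelfEquivGroup X × SelfEquivGroup Z) : p ∈ mapSelfEquivGroup (g.comp f) := by
    obtain ⟨a, ha⟩ := Quotient.exists_rep (p.1 : HomotopyClass X X)
    obtain ⟨b, hb⟩ := Quotient.exists_rep (p.2 : HomotopyClass Z Z)
    change (HomotopyClass.mk (g.comp f)).comp (p.1 : HomotopyClass X X) =
      (p.2 : HomotopyClass Z Z).comp (HomotopyClass.mk (g.comp f))
    rw [← ha, ← hb]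
    -- Both composites factor through the contractible space.
    exact (HomotopyClass.mk_eq_mk_iff _ _).2 (((hX (f.comp a)).comp_right g).homotopic
      (((hX f).comp_right g).comp_right b))
  ext p
  exact iff_of_true ⟨1, h1 _, h2 _⟩ (h3 p)

/-! ### Contractibility of the based path space -/

/-- Based path spaces are contracted by shortening the paths. -/
theorem contractibleSpace_basedPathSpace (X : Type*) [TopologicalSpace X] (x₀ : X) :
    ContractibleSpace (BasedPathSpace X x₀) := by
  -- Currying this jointly continuous map gives continuity into the compact-open topology.
  let F : C((I × BasedPathSpace X x₀) × I, X) :=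
    ⟨fun z => z.1.2.1 (unitInterval.symm z.1.1 * z.2), by fun_prop⟩
  have hF (z) : F.curry z 0 = x₀ := by
    change z.2.1 (unitInterval.symm z.1 * 0) = x₀
    rw [mul_zero, z.2.2]
  let H : C(I × BasedPathSpace X x₀, BasedPathSpace X x₀) :=
    ⟨fun z => ⟨F.curry z, hF z⟩, F.curry.continuous.subtype_mk hF⟩
  refine (contractible_iff_id_nullhomotopic _).2
    ⟨⟨ContinuousMap.const I x₀, rfl⟩, ⟨⟨H, fun γ => ?_, fun γ => ?_⟩⟩⟩
  · refine Subtype.ext (ContinuousMap.ext fun t => ?_)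
    change γ.1 (unitInterval.symm 0 * t) = γ.1 t
    rw [unitInterval.symm_zero, one_mul]
  · refine Subtype.ext (ContinuousMap.ext fun t => ?_)
    change γ.1 (unitInterval.symm 1 * t) = x₀
    rw [unitInterval.symm_one, zero_mul, γ.2]

/-! ### Coordinates on the infinite join -/

namespace MilnorE

open Convexity

variable {G : Type*}

/-- All the weights of a point of the infinite join. -/
def weights (e : MilnorE G) : StdSimplex ℝ ℕ := (Quotient.out (s := milnorSetoid G) e).1

/-- A choice of labels of a point of the infinite join, meaningful where the weight is positive. -/
def labels (e : MilnorE G) : ℕ → G := (Quotient.out (s := milnorSetoid G) e).2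

@[simp] theorem mk_weights_labels (e : MilnorE G) : mk e.weights e.labels = e :=
  Quotient.out_eq (s := milnorSetoid G) e

@[simp] theorem weights_apply (e : MilnorE G) (i : ℕ) : e.weights.weights i = weight i e := by
  conv_rhs => rw [← mk_weights_labels e]
  rfl

theorem weight_nonneg (i : ℕ) (e : MilnorE G) : 0 ≤ weight i e := by
  rw [← weights_apply]
  exact StdSimplex.weights_nonneg i

theorem continuous_weight [TopologicalSpace G] (i : ℕ) : Continuous (weight i : MilnorE G → ℝ) :=
  continuous_def.2 fun U hU => by
    refine TopologicalSpace.isOpen_generateFrom_of_mem ?_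
    exact Or.inl ⟨i, U, hU, rfl⟩

theorem isOpen_labels_mem [TopologicalSpace G] (i : ℕ) {V : Set G} (hV : IsOpen V) :
    IsOpen {e : MilnorE G | 0 < weight i e ∧ e.labels i ∈ V} := by
  have hopen : IsOpen (Subtype.val '' (label i ⁻¹' V) : Set (MilnorE G)) := by
    refine TopologicalSpace.isOpen_generateFrom_of_mem ?_
    exact Or.inr ⟨i, V, hV, rfl⟩
  convert hopen using 1
  ext e
  have h := mk_mem_image_label i V e.weights e.labels
  rw [mk_weights_labels, weights_apply] at h
  exact h.symm

/-- Continuity of a map into the infinite join, given by weights and labels. -/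
theorem continuous_mk [TopologicalSpace G] {Z : Type*} [TopologicalSpace Z] {w : Z → StdSimplex ℝ ℕ} {x : Z → ℕ → G}
    (hw : ∀ i, Continuous fun z => (w z).weights i)
    (hx : ∀ i V, IsOpen V → IsOpen {z | 0 < (w z).weights i ∧ x z i ∈ V}) :
    Continuous fun z => mk (w z) (x z) := by
  refine continuous_generateFrom_iff.2 ?_
  rintro S (⟨i, U, hU, rfl⟩ | ⟨i, V, hV, rfl⟩)
  · exact hU.preimage (hw i)
  · convert hx i V hV using 1
    ext z
    exact mk_mem_image_label i V (w z) (x z)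

/-! ### Motion of the summands -/

/-- The displacement at time `s` of the `i`-th summand, in the homotopy which spreads the summands
out over the even positions: it grows from `0` to `i`. -/
def displacement (i : ℕ) (s : I) : ℝ := (i + 1) - (max (s : ℝ) ((i : ℝ) + 1)⁻¹)⁻¹

theorem continuous_displacement (i : ℕ) : Continuous (displacement i) := by
  refine continuous_const.sub (Continuous.inv₀ (by fun_prop) fun s => ?_)
  exact (lt_max_of_lt_right (by positivity)).ne'

theorem displacement_nonneg (i : ℕ) (s : I) : 0 ≤ displacement i s := by
  have : (max (s : ℝ) ((i : ℝ) + 1)⁻¹)⁻¹ ≤ (i : ℝ) + 1 :=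
    inv_le_of_inv_le₀ (by positivity) (le_max_right _ _)
  exact sub_nonneg.2 this

@[simp] theorem displacement_zero (i : ℕ) : displacement i 0 = 0 := by
  have : (0 : ℝ) ≤ ((i : ℝ) + 1)⁻¹ := by positivity
  simp [displacement, max_eq_right this]

@[simp] theorem displacement_one (i : ℕ) : displacement i 1 = i := by
  have : ((i : ℝ) + 1)⁻¹ ≤ 1 := inv_le_one_of_one_le₀ (by linarith [i.cast_nonneg (α := ℝ)])
  simp [displacement, max_eq_left this]

/-- Summand `i` starts at time `1/(i+1)`, so `j` is already moving when `i` does. Both displacements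
then have the form index `+ 1 - 1/s` and differ by `j - i`. -/
theorem displacement_add_one_le {i j : ℕ} (hij : i < j) {s : I} (h : 0 < displacement i s) :
    displacement i s + 1 ≤ displacement j s := by
  have hi : (0 : ℝ) < (i : ℝ) + 1 := by positivity
  have hij' : (i : ℝ) + 1 ≤ j := by exact_mod_cast hij
  have hs : ((i : ℝ) + 1)⁻¹ ≤ s := by
    by_contra! hs
    simp [displacement, max_eq_right hs.le] at h
  have hs' : ((j : ℝ) + 1)⁻¹ ≤ s := (inv_anti₀ hi (by linarith)).trans hs
  rw [displacement, displacement, max_eq_left hs, max_eq_left hs']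
  linarith

/-- The proportion at position `p` of a summand located at the real number `a`. -/
def tent (a : ℝ) (p : ℕ) : ℝ := max 0 (1 - |(p : ℝ) - a|)

theorem continuous_tent (p : ℕ) : Continuous fun a => tent a p := by
  unfold tent
  fun_prop

theorem tent_nonneg (a : ℝ) (p : ℕ) : 0 ≤ tent a p := le_max_left _ _

theorem tent_pos_iff {a : ℝ} {p : ℕ} : 0 < tent a p ↔ |(p : ℝ) - a| < 1 := by
  simp [tent]

theorem tent_eq_zero {a : ℝ} {p : ℕ} (h : (p : ℝ) + 1 ≤ a) : tent a p = 0 := by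
  refine max_eq_left ?_
  have := neg_le_abs ((p : ℝ) - a)
  linarith

theorem tent_natCast (m p : ℕ) : tent m p = if p = m then 1 else 0 := by
  split_ifs with h
  · simp [tent, h]
  · refine max_eq_left ?_
    have h1 : (1 : ℤ) ≤ |(p : ℤ) - m| := Int.one_le_abs (by omega)
    have h2 : (1 : ℝ) ≤ |(p : ℝ) - m| := by exact_mod_cast h1
    linarith

/-- The distribution `tent a` over the two integers next to `a`. -/
def tentSimplex (a : ℝ) : StdSimplex ℝ ℕ :=
  -- The `max` matters only for negative `a`, where it keeps the weights nonnegative.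
  StdSimplex.duple ⌊a⌋₊ (⌊a⌋₊ + 1) (s := max 0 (1 - |⌊a⌋₊ - a|)) (t := 1 - max 0 (1 - |⌊a⌋₊ - a|))
    (le_max_left _ _) (sub_nonneg.2 (max_le zero_le_one (sub_le_self _ (abs_nonneg _))))
    (add_sub_cancel _ _)

theorem tentSimplex_weights {a : ℝ} (ha : 0 ≤ a) (p : ℕ) :
    (tentSimplex a).weights p = tent a p := by
  have h1 := Nat.floor_le ha
  have h2 := Nat.lt_floor_add_one a
  have h3 : |(⌊a⌋₊ : ℝ) - a| = a - ⌊a⌋₊ := by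
    rw [abs_sub_comm, abs_of_nonneg (by linarith)]
  rw [tentSimplex, StdSimplex.weights_duple, Finsupp.add_apply, Finsupp.single_apply,
    Finsupp.single_apply, h3, max_eq_right (by linarith), tent]
  generalize ⌊a⌋₊ = n at *
  rcases lt_trichotomy p n with h | rfl | h
  · have : (p : ℝ) + 1 ≤ n := by exact_mod_cast h
    rw [if_neg (by omega), if_neg (by omega), max_eq_left, add_zero]
    have := neg_le_abs ((p : ℝ) - a)
    linarith
  · rw [if_pos rfl, if_neg (by omega), h3, max_eq_right (by linarith), add_zero]
  · rw [if_neg (by omega), zero_add]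
    split_ifs with h'
    · rw [← h']
      push_cast
      rw [abs_of_nonneg (by linarith), max_eq_right (by linarith)]
      ring
    · have : (n : ℝ) + 2 ≤ p := by exact_mod_cast (by omega : n + 2 ≤ p)
      have := le_abs_self ((p : ℝ) - a)
      rw [max_eq_left (by linarith)]

/-- The location of the `i`-th summand at time `s`. -/
def location (s : I) (i : ℕ) : ℝ := i + displacement i s

theorem le_location (s : I) (i : ℕ) : (i : ℝ) ≤ location s i :=
  le_add_of_nonneg_right (displacement_nonneg i s)

theorem location_nonneg (s : I) (i : ℕ) : 0 ≤ location s i :=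
  i.cast_nonneg.trans (le_location s i)

theorem continuous_tent_location (i p : ℕ) : Continuous fun s => tent (location s i) p :=
  (continuous_tent p).comp (continuous_const.add (continuous_displacement i))

/-- Tents have radius `1`. If `i` is at rest, its tent meets only the integer `i`, and `j` is at
least `1` further on; if `i` moves, the two locations are at least `2` apart. -/
theorem not_tent_pos_of_lt {s : I} {i j p : ℕ} (hij : i < j) (hi : 0 < tent (location s i) p) :
    ¬ 0 < tent (location s j) p := by
  intro hj
  rw [tent_pos_iff, abs_lt] at hi hj
  have hij' : (i : ℝ) + 1 ≤ j := by exact_mod_cast hij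
  rcases (displacement_nonneg i s).eq_or_lt with h | h
  · rw [location, ← h, add_zero] at hi
    have h1 : (p : ℝ) < i + 1 := by linarith
    have h2 : p ≤ i := Nat.lt_succ_iff.1 (by exact_mod_cast h1)
    have h3 : (p : ℝ) ≤ i := by exact_mod_cast h2
    linarith [le_location s j]
  · have := displacement_add_one_le hij h
    unfold location at hi hj
    linarith

theorem eq_of_tent_pos {s : I} {i j p : ℕ} (hi : 0 < tent (location s i) p)
    (hj : 0 < tent (location s j) p) : i = j := by
  by_contra h
  rcases Nat.lt_or_gt_of_ne h with h | h
  · exact not_tent_pos_of_lt h hi hj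
  · exact not_tent_pos_of_lt h hj hi

open Classical in
/-- The index of the summand which is found at position `p` at time `s`. -/
def source (s : I) (p : ℕ) : ℕ :=
  -- The default is harmless: a position reached by no summand has weight zero, so its label is
  -- disregarded.
  if h : ∃ i, 0 < tent (location s i) p then h.choose else 0

theorem source_eq {s : I} {i p : ℕ} (h : 0 < tent (location s i) p) : source s p = i := by
  have h' : ∃ i, 0 < tent (location s i) p := ⟨i, h⟩
  rw [source, dif_pos h']
  exact eq_of_tent_pos h'.choose_spec h

/-! ### The spreading homotopy -/

/-- The weights of a point of the infinite join after spreading it out up to time `s`. -/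
def spreadWeights (s : I) (t : StdSimplex ℝ ℕ) : StdSimplex ℝ ℕ :=
  (t.map fun i => tentSimplex (location s i)).join

/-- Summands never move left, so only indices `i ≤ p` reach position `p`. This finite range,
independent of the point, yields continuity. -/
theorem spreadWeights_weights (s : I) (t : StdSimplex ℝ ℕ) (p : ℕ) :
    (spreadWeights s t).weights p =
      ∑ i ∈ Finset.range (p + 1), t.weights i * tent (location s i) p := by
  rw [spreadWeights, StdSimplex.weights_join, StdSimplex.weights_map,
    Finsupp.sum_mapDomain_index (by simp) (by simp [add_smul]), Finsupp.sum_apply, Finsupp.sum]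
  simp only [Finsupp.smul_apply, smul_eq_mul, tentSimplex_weights (location_nonneg s _)]
  refine Finset.sum_congr_of_eq_on_inter ?_ ?_ fun _ _ _ => rfl
  · intro i _ hi
    have : (p : ℝ) + 1 ≤ i := by exact_mod_cast (by simpa using hi : p + 1 ≤ i)
    rw [tent_eq_zero (this.trans (le_location s i)), mul_zero]
  · intro i _ hi
    rw [Finsupp.notMem_support_iff.1 hi, zero_mul]

/-- The homotopy from the identity which spreads the summands out over the even positions. -/
def spread (s : I) (e : MilnorE G) : MilnorE G :=
  mk (spreadWeights s e.weights) fun p => e.labels (source s p)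

theorem continuous_spread [TopologicalSpace G] : Continuous fun z : I × MilnorE G => spread z.1 z.2 := by
  refine continuous_mk (fun p => ?_) fun p V hV => ?_
  · simp only [spreadWeights_weights, weights_apply]
    exact continuous_finsetSum _ fun i _ => ((continuous_weight i).comp continuous_snd).mul
      ((continuous_tent_location i p).comp continuous_fst)
  -- On each rectangle the source of position `p` is constantly `i`, so the label condition is open
  -- there.
  · have : {z : I × MilnorE G | 0 < (spreadWeights z.1 z.2.weights).weights p ∧
          z.2.labels (source z.1 p) ∈ V} =
        ⋃ i ∈ Finset.range (p + 1),
          {s | 0 < tent (location s i) p} ×ˢ {e | 0 < weight i e ∧ e.labels i ∈ V} := by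
      ext ⟨s, e⟩
      simp only [Set.mem_ofPred_eq, Set.mem_iUnion, Set.mem_prod, spreadWeights_weights,
        weights_apply]
      constructor
      · rintro ⟨h, hV⟩
        obtain ⟨i, hi, h⟩ := Finset.exists_lt_of_sum_lt (s := Finset.range (p + 1))
          (f := fun _ => (0 : ℝ)) (by simpa using h)
        have h1 := pos_of_mul_pos_right h (weight_nonneg i e)
        exact ⟨i, hi, h1, pos_of_mul_pos_left h (tent_nonneg _ _), source_eq h1 ▸ hV⟩
      · rintro ⟨i, hi, h1, h2, h3⟩
        refine ⟨Finset.sum_pos' (fun j _ => mul_nonneg (weight_nonneg j e) (tent_nonneg _ _))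
          ⟨i, hi, mul_pos h2 h1⟩, ?_⟩
        rwa [source_eq h1]
    rw [this]
    exact isOpen_biUnion fun i _ =>
      (isOpen_lt continuous_const (continuous_tent_location i p)).prod (isOpen_labels_mem i hV)

theorem spread_zero (e : MilnorE G) : spread 0 e = e := by
  have h (p i : ℕ) : tent (location 0 i) p = if p = i then 1 else 0 := by
    rw [location, displacement_zero, add_zero, tent_natCast]
  conv_rhs => rw [← mk_weights_labels e]
  refine (mk_eq_mk_iff _ _ _ _).2 ⟨?_, fun p _ => ?_⟩
  · ext p
    simp [spreadWeights_weights, h]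
  · rw [source_eq (i := p) (by simp [h])]

/-- At time `1` summand `i` sits at `2i`, which leaves position `1` free to be the cone vertex. -/
theorem weight_one_spread_one (e : MilnorE G) : weight 1 (spread 1 e) = 0 := by
  rw [spread, weight_mk, spreadWeights_weights]
  refine Finset.sum_eq_zero fun i _ => ?_
  have : location 1 i = ((i + i : ℕ) : ℝ) := by simp [location]
  rw [this, tent_natCast, if_neg (by omega), mul_zero]

/-! ### The cone to an unused vertex -/

/-- The weights of the linear homotopy to the vertex at position `1`. -/
def coneWeights (s : I) (t : StdSimplex ℝ ℕ) : StdSimplex ℝ ℕ :=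
  (StdSimplex.duple t (StdSimplex.single 1) (s := 1 - (s : ℝ)) (t := s)
    (sub_nonneg.2 s.2.2) s.2.1 (sub_add_cancel _ _)).join

theorem coneWeights_weights (s : I) (t : StdSimplex ℝ ℕ) (p : ℕ) :
    (coneWeights s t).weights p = (1 - s) * t.weights p + s * if p = 1 then 1 else 0 := by
  classical
  rw [coneWeights, StdSimplex.weights_join, StdSimplex.weights_duple,
    Finsupp.sum_add_index (by simp) (by simp [add_smul]), Finsupp.sum_single_index (by simp),
    Finsupp.sum_single_index (by simp)]
  simp [Finsupp.single_apply, eq_comm]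

/-- The linear homotopy to a vertex at position `1`, of points which have no weight there. -/
def cone [One G] (s : I) (e : MilnorE G) : MilnorE G :=
  mk (coneWeights s e.weights) (Function.update e.labels 1 1)

theorem continuous_cone [TopologicalSpace G] [One G] {Z : Type*} [TopologicalSpace Z] {F : Z → MilnorE G}
    (hF : Continuous F) :
    Continuous fun z : I × Z => cone z.1 (F z.2) := by
  have hw (p : ℕ) : Continuous fun z : I × Z => weight p (F z.2) :=
    (continuous_weight p).comp (hF.comp continuous_snd)
  have hc (p : ℕ) : Continuous fun z : I × Z => (coneWeights z.1 (F z.2).weights).weights p := by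
    simp only [coneWeights_weights, weights_apply]
    have := hw p
    fun_prop
  refine continuous_mk hc fun p V hV => ?_
  by_cases hp : p = 1
  · subst hp
    simp only [Function.update_self]
    exact (isOpen_lt continuous_const (hc 1)).and isOpen_const
  · have : {z : I × Z | 0 < (coneWeights z.1 (F z.2).weights).weights p ∧
          Function.update (F z.2).labels 1 1 p ∈ V} =
        {s : I | (s : ℝ) < 1} ×ˢ (F ⁻¹' {e | 0 < weight p e ∧ e.labels p ∈ V}) := by
      ext ⟨s, z⟩
      simp only [coneWeights_weights, weights_apply, if_neg hp, mul_zero, add_zero,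
        Function.update_of_ne hp, Set.mem_ofPred_eq, Set.mem_prod, Set.mem_preimage]
      constructor
      · rintro ⟨h1, h2⟩
        exact ⟨sub_pos.1 (pos_of_mul_pos_left h1 (weight_nonneg p _)),
          pos_of_mul_pos_right h1 (sub_nonneg.2 s.2.2), h2⟩
      · rintro ⟨h1, h2, h3⟩
        exact ⟨mul_pos (sub_pos.2 h1) h2, h3⟩
    rw [this]
    exact (isOpen_lt continuous_subtype_val continuous_const).prod
      ((isOpen_labels_mem p hV).preimage hF)

/-- `cone` overwrites the label at position `1`; zero weight there makes this invisible at time `0`.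
-/
theorem cone_zero [One G] {e : MilnorE G} (h : weight 1 e = 0) : cone 0 e = e := by
  conv_rhs => rw [← mk_weights_labels e]
  have hw : coneWeights 0 e.weights = e.weights := by
    ext p
    simp [coneWeights_weights]
  refine (mk_eq_mk_iff _ _ _ _).2 ⟨hw, fun p hp => Function.update_of_ne ?_ _ _⟩
  rintro rfl
  rw [hw, weights_apply, h] at hp
  exact hp.false

theorem cone_one [One G] (e : MilnorE G) : cone 1 e = mk (StdSimplex.single 1) 1 := by
  have hw : coneWeights 1 e.weights = StdSimplex.single 1 := by
    ext p
    simp [coneWeights_weights, Finsupp.single_apply, eq_comm]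
  refine (mk_eq_mk_iff _ _ _ _).2 ⟨hw, fun p hp => ?_⟩
  rw [coneWeights_weights] at hp
  by_cases h : p = 1
  · simp [h]
  · simp [h] at hp

instance contractibleSpace [TopologicalSpace G] [One G] : ContractibleSpace (MilnorE G) := by
  have hf : Continuous fun e : MilnorE G => spread 1 e := by
    have h : Continuous fun e : MilnorE G => ((1 : I), e) := by fun_prop
    have h' := continuous_spread.comp h
    exact h'
  let f : C(MilnorE G, MilnorE G) := ⟨fun e => spread 1 e, hf⟩
  let S : (ContinuousMap.id (MilnorE G)).Homotopy f :=
    { toFun := fun z => spread z.1 z.2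
      continuous_toFun := continuous_spread
      map_zero_left := spread_zero
      map_one_left := fun _ => rfl }
  let C : f.Homotopy (ContinuousMap.const _ (mk (StdSimplex.single 1) 1)) :=
    { toFun := fun z => cone z.1 (f z.2)
      continuous_toFun := continuous_cone f.continuous
      map_zero_left := fun e => cone_zero (weight_one_spread_one e)
      map_one_left := fun e => cone_one _ }
  exact (contractible_iff_id_nullhomotopic _).2 ⟨_, ⟨S.trans C⟩⟩

end MilnorE

end

theorem mainTheorem7 :
    (∀ (X : Type*) [TopologicalSpace X] [PathConnectedSpace X] (x₀ : X),
      ContractibleSpace (BasedPathSpace X x₀) ∧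
        IsStrictFunctorPair (loopInclusion x₀) (pathEndpoint x₀)) ∧
    (∀ (G : Type*) [TopologicalSpace G] [Group G] [IsTopologicalGroup G],
      ContractibleSpace (MilnorE G) ∧
        ∀ e : MilnorE G, IsStrictFunctorPair (milnorFiber e) (milnorProjection G)) := by
  refine ⟨fun X _ _ x₀ => ?_, fun G _ _ _ => ⟨inferInstance, fun e => ?_⟩⟩
  · have := contractibleSpace_basedPathSpace X x₀
    exact ⟨this, isStrictFunctorPair_of_contractibleSpace _ _⟩
  -- `BG` is a continuous image of the contractible space `EG`.
  · have : PathConnectedSpace (MilnorB G) :=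
      Quotient.mk_surjective.pathConnectedSpace (milnorProjection G).continuous
    exact isStrictFunctorPair_of_contractibleSpace _ _
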